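/- All rings are unital, nontrivial and not necessarily commutative. A ring $R$ is called *fadelian* if for every $x \in R$ and every nonzero $a \in R$ there exist $b, c \in R$ such that $x = ab + ca$. **Theorem.** There exists a countable fadelian ring that is neither left Noetherian nor right Noetherian. -/

import Mathlib

/-- A (unital, not necessarily commutative) ring `R` is fadelian if it is nontrivial and for every
`x` and every nonzero `a` in `R` there exist `b`, `c` in `R` such that `x = a * b + c * a`. -/
structure IsFadelian (R : Type*) [Ring R] : Prop where
  nontrivial : Nontrivial R
  exists_eq_mul_add_mul : ∀ x a : R, a ≠ 0 → ∃ b c : R, x = a * b + c * a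

/-- Left Noetherian: `R` is Noetherian as a left module over itself. -/
def IsLeftNoetherian (R : Type*) [Ring R] : Prop :=
  IsNoetherian R R

/-- Right Noetherian: `R` is Noetherian as a right module over itself, a right `R`-module being a
module over the opposite ring, which acts on `R` by right multiplication. -/
def IsRightNoetherian (R : Type*) [Ring R] : Prop :=
  IsNoetherian Rᵐᵒᵖ R

/-! Let `K` be an algebraically closed field of characteristic 2, `F` its Frobenius, and consider
the twisted Laurent polynomials in `F` over `K`, with `F a = a ^ 2 F`. An additive polynomial with
nonzero linear coefficient that is not a scalar has a nonzero root, so every nonzero element is a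
product of units and factors `F - v`, `v ≠ 0` (`mem_closure_factors`). The condition `g R + R h = R`
passes to products in `g` and in `h` separately (`IsFadelian.of_closure`), so it need only be
checked on such factors. There, division by `F - w` leaves a scalar, and a quadratic equation over
`K` absorbs it.

To destroy the Noetherian conditions, take an ultrapower of this domain: it stays fadelian, and for
the nonunit `a = F - 1` the elements `a ^ (ω - k)`, with `ω` infinite, generate strictly ascending
chains of left and right ideals. Closing these elements under the ring operations and chosen
fadelian witnesses gives a countable ring. -/

/-! ### Noetherian obstructions and a multiplicative criterion for fadelian rings. -/

theorem not_isNoetherian_of_chain {R M : Type*} [Ring R] [AddCommGroup M] [Module R M]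
    (t : ℕ → M) (ht : ∀ k, t k ∈ Submodule.span R {t (k + 1)})
    (ht' : ∀ k, t (k + 1) ∉ Submodule.span R {t k}) : ¬ IsNoetherian R M := by
  intro h
  have hmono : Monotone fun k => Submodule.span R {t k} :=
    monotone_nat_of_le_succ fun k => by
      rw [Submodule.span_singleton_le_iff_mem]
      exact ht k
  obtain ⟨n, hn⟩ := monotone_stabilizes_iff_noetherian.mpr h ⟨_, hmono⟩
  apply ht' n
  have := hn (n + 1) n.le_succ
  simp only [OrderHom.coe_mk] at this
  rw [this]
  exact Submodule.mem_span_singleton_self _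

theorem not_isLeftNoetherian_of_chain {R : Type*} [Ring R] (t : ℕ → R) (a : R)
    (ht : ∀ k, t k = a * t (k + 1)) (ht' : ∀ k c, t (k + 1) ≠ c * t k) :
    ¬ IsLeftNoetherian R := by
  refine not_isNoetherian_of_chain t (fun k => ?_) fun k hk => ?_
  · exact Submodule.mem_span_singleton.mpr ⟨a, (ht k).symm⟩
  · obtain ⟨c, hc⟩ := Submodule.mem_span_singleton.mp hk
    exact ht' k c hc.symm

theorem not_isRightNoetherian_of_chain {R : Type*} [Ring R] (t : ℕ → R) (a : R)
    (ht : ∀ k, t k = t (k + 1) * a) (ht' : ∀ k c, t (k + 1) ≠ t k * c) :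
    ¬ IsRightNoetherian R := by
  refine not_isNoetherian_of_chain t (fun k => ?_) fun k hk => ?_
  · exact Submodule.mem_span_singleton.mpr ⟨MulOpposite.op a, (ht k).symm⟩
  · obtain ⟨c, hc⟩ := Submodule.mem_span_singleton.mp hk
    exact ht' k c.unop hc.symm

/-- A ring is fadelian as soon as `g R + R h = R` for all `g`, `h` in a set that multiplicatively
generates all nonzero elements. -/
theorem IsFadelian.of_closure {R : Type*} [Ring R] [Nontrivial R] (G : Set R)
    (hG : ∀ a : R, a ≠ 0 → a ∈ Submonoid.closure G)
    (hsolve : ∀ g ∈ G, ∀ h ∈ G, ∀ x : R, ∃ b c : R, x = g * b + c * h) : IsFadelian R := by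
  refine ⟨inferInstance, fun x a ha => ?_⟩
  -- Decoupling the left and right factors is what makes induction on products possible.
  have key : ∀ g ∈ Submonoid.closure G, ∀ h ∈ Submonoid.closure G, ∀ x : R,
      ∃ b c : R, x = g * b + c * h := by
    intro g hg h hh
    induction hg using Submonoid.closure_induction with
    | mem g hg =>
      induction hh using Submonoid.closure_induction with
      | mem h hh => exact hsolve g hg h hh
      | one => exact fun x => ⟨0, x, by simp⟩
      | mul h₁ h₂ _ _ ih₁ ih₂ =>
        intro x
        obtain ⟨b, c, rfl⟩ := ih₂ x
        obtain ⟨b', c', rfl⟩ := ih₁ c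
        exact ⟨b + b' * h₂, c', by noncomm_ring⟩
    | one => exact fun x => ⟨x, 0, by simp⟩
    | mul g₁ g₂ _ _ ih₁ ih₂ =>
      intro x
      obtain ⟨b, c, rfl⟩ := ih₁ x
      obtain ⟨b', c', rfl⟩ := ih₂ b
      exact ⟨b', g₁ * c' + c, by noncomm_ring⟩
  exact key a (hG a ha) a (hG a ha) x

/-! ### Ultrapowers and countable fadelian subrings. -/

theorem IsFadelian.germ {R : Type*} [Ring R] (hR : IsFadelian R) {ι : Type*} (U : Ultrafilter ι) :
    IsFadelian (Filter.Germ (U : Filter ι) R) := by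
  have := hR.nontrivial
  refine ⟨inferInstance, fun x a => ?_⟩
  induction x using Filter.Germ.inductionOn with | _ x =>
  induction a using Filter.Germ.inductionOn with | _ a =>
  intro ha
  have ha' : ∀ᶠ i in (U : Filter ι), a i ≠ 0 := by
    rw [Ultrafilter.eventually_not]
    exact fun h => ha (Filter.Germ.coe_eq.mpr h)
  have hex : ∀ i, ∃ b c : R, a i ≠ 0 → x i = a i * b + c * a i := by
    intro i
    by_cases h : a i = 0
    · exact ⟨0, 0, fun h' => absurd h h'⟩
    · obtain ⟨b, c, hbc⟩ := hR.exists_eq_mul_add_mul (x i) (a i) h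
      exact ⟨b, c, fun _ => hbc⟩
  choose b c hbc using hex
  refine ⟨(b : Filter.Germ (U : Filter ι) R), (c : Filter.Germ (U : Filter ι) R), ?_⟩
  rw [← Filter.Germ.coe_mul, ← Filter.Germ.coe_mul, ← Filter.Germ.coe_add, Filter.Germ.coe_eq]
  filter_upwards [ha'] with i hi using hbc i hi

theorem exists_countable_closed {α ι : Type*} [Countable ι] (f : ι → α → α → α) (s : Set α)
    (hs : s.Countable) :
    ∃ t : Set α, s ⊆ t ∧ t.Countable ∧ ∀ i, ∀ x ∈ t, ∀ y ∈ t, f i x y ∈ t := by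
  let S : ℕ → Set α := fun n => Nat.rec s (fun _ u => u ∪ ⋃ i, Set.image2 (f i) u u) n
  have hS : ∀ n, S (n + 1) = S n ∪ ⋃ i, Set.image2 (f i) (S n) (S n) := fun n => rfl
  have hmono : Monotone S := monotone_nat_of_le_succ fun n => by
    rw [hS]
    exact Set.subset_union_left
  have hcount : ∀ n, (S n).Countable := by
    intro n
    induction n with
    | zero => exact hs
    | succ n ih =>
      rw [hS]
      exact ih.union (Set.countable_iUnion fun i => ih.image2 ih (f i))
  refine ⟨⋃ n, S n, Set.subset_iUnion S 0, Set.countable_iUnion hcount, ?_⟩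
  intro i x hx y hy
  obtain ⟨m, hm⟩ := Set.mem_iUnion.mp hx
  obtain ⟨n, hn⟩ := Set.mem_iUnion.mp hy
  refine Set.mem_iUnion.mpr ⟨max m n + 1, ?_⟩
  rw [hS]
  exact Or.inr (Set.mem_iUnion.mpr ⟨i, Set.mem_image2_of_mem (hmono (le_max_left m n) hm)
    (hmono (le_max_right m n) hn)⟩)

theorem IsFadelian.exists_countable_subring {R : Type*} [Ring R] (hR : IsFadelian R) (s : Set R)
    (hs : s.Countable) :
    ∃ A : Subring R, s ⊆ A ∧ Countable A ∧ IsFadelian A := by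
  have := hR.nontrivial
  -- Made total by a junk value at `a = 0`, the witnesses become two more binary operations to close
  -- under.
  have hex : ∀ x a : R, ∃ b c : R, a ≠ 0 → x = a * b + c * a := by
    intro x a
    by_cases h : a = 0
    · exact ⟨0, 0, fun h' => absurd h h'⟩
    · obtain ⟨b, c, hbc⟩ := hR.exists_eq_mul_add_mul x a h
      exact ⟨b, c, fun _ => hbc⟩
  choose b c hbc using hex
  obtain ⟨t, hst, htc, ht⟩ := exists_countable_closed
    (![(· + ·), (· * ·), (· - ·), b, c] : Fin 5 → R → R → R) (s ∪ {0, 1})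
    (hs.union (by simp))
  have h0 : (0 : R) ∈ t := hst (by simp)
  have hadd := ht 0
  have hmul := ht 1
  have hsub := ht 2
  have hb := ht 3
  have hc := ht 4
  simp at hadd hmul hsub hb hc
  let A : Subring R :=
    { carrier := t
      zero_mem' := h0
      one_mem' := hst (by simp)
      add_mem' := fun {x y} hx hy => hadd x hx y hy
      mul_mem' := fun {x y} hx hy => hmul x hx y hy
      neg_mem' := fun {x} hx => by simpa using hsub 0 h0 x hx }
  refine ⟨A, fun x hx => hst (Or.inl hx), htc.to_subtype, inferInstance, fun x a ha => ?_⟩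
  refine ⟨⟨b x a, hb _ x.2 _ a.2⟩, ⟨c x a, hc _ x.2 _ a.2⟩, Subtype.ext ?_⟩
  exact hbc x a fun h => ha (Subtype.ext h)

/-- In an ultrapower of a fadelian domain, the nonstandard powers of a nonunit generate strictly
ascending chains of left and right ideals, and these survive in a countable fadelian subring. -/
theorem IsFadelian.exists_countable_not_noetherian {R : Type} [Ring R] [NoZeroDivisors R]
    (hR : IsFadelian R) (a : R) (ha : a ≠ 0) (hleft : ∀ c, c * a ≠ 1) (hright : ∀ c, a * c ≠ 1) :
    ∃ (A : Type) (_ : Ring A),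
      Countable A ∧ IsFadelian A ∧ ¬ IsLeftNoetherian A ∧ ¬ IsRightNoetherian A := by
  have := hR.nontrivial
  have : IsDomain R := NoZeroDivisors.to_isDomain R
  let U := Filter.hyperfilter ℕ
  let B := Filter.Germ (U : Filter ℕ) R
  -- The truncation of `m - k` is invisible in the germ, since `k < m` for almost all `m`.
  let t : ℕ → B := fun k => ((fun m => a ^ (m - k) : ℕ → R) : B)
  let α : B := ((fun _ => a : ℕ → R) : B)
  have hlarge : ∀ k : ℕ, ∀ᶠ m in (U : Filter ℕ), k < m := fun k =>
    (Nat.hyperfilter_le_atTop : (U : Filter ℕ) ≤ _) (Filter.eventually_gt_atTop k)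
  have ht : ∀ k, t k = α * t (k + 1) := fun k => by
    refine Filter.Germ.coe_eq.mpr ?_
    filter_upwards [hlarge k] with m hm
    exact (congrArg _ (by omega)).trans (pow_succ' a _)
  have ht' : ∀ k, t k = t (k + 1) * α := fun k => by
    refine Filter.Germ.coe_eq.mpr ?_
    filter_upwards [hlarge k] with m hm
    exact (congrArg _ (by omega)).trans (pow_succ a _)
  have hl : ∀ k c, t (k + 1) ≠ c * t k := fun k c => by
    induction c using Filter.Germ.inductionOn with | _ c =>
    intro h
    obtain ⟨m, hm, hkm⟩ := ((Filter.Germ.coe_eq.mp h).and (hlarge k)).exists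
    have hm : a ^ (m - (k + 1)) = c m * a ^ (m - k) := hm
    have e : m - k = m - (k + 1) + 1 := by omega
    rw [e, pow_succ', ← mul_assoc] at hm
    exact hleft (c m) (mul_right_cancel₀ (pow_ne_zero _ ha) (by rw [← hm, one_mul]))
  have hr : ∀ k c, t (k + 1) ≠ t k * c := fun k c => by
    induction c using Filter.Germ.inductionOn with | _ c =>
    intro h
    obtain ⟨m, hm, hkm⟩ := ((Filter.Germ.coe_eq.mp h).and (hlarge k)).exists
    have hm : a ^ (m - (k + 1)) = a ^ (m - k) * c m := hm
    have e : m - k = m - (k + 1) + 1 := by omega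
    rw [e, pow_succ, mul_assoc] at hm
    exact hright (c m) (mul_left_cancel₀ (pow_ne_zero _ ha) (by rw [← hm, mul_one]))
  obtain ⟨A, hA, hAc, hAf⟩ := (hR.germ U).exists_countable_subring (insert α (Set.range t))
    ((Set.countable_range t).insert α)
  have hαA : α ∈ A := hA (Set.mem_insert _ _)
  have htA : ∀ k, t k ∈ A := fun k => hA (Or.inr ⟨k, rfl⟩)
  refine ⟨A, inferInstance, hAc, hAf, ?_, ?_⟩
  · exact not_isLeftNoetherian_of_chain (fun k => (⟨t k, htA k⟩ : A)) ⟨α, hαA⟩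
      (fun k => Subtype.ext (ht k)) fun k c h => hl k c (congrArg Subtype.val h)
  · exact not_isRightNoetherian_of_chain (fun k => (⟨t k, htA k⟩ : A)) ⟨α, hαA⟩
      (fun k => Subtype.ext (ht' k)) fun k c h => hr k c (congrArg Subtype.val h)

/-! ### Additive polynomials in characteristic 2. -/

section TwistedPolynomials

open Polynomial

variable {K : Type*} [Field K] [CharP K 2]

/-- The Frobenius `x ↦ x ^ 2` as an additive endomorphism. -/
def frobEnd (K : Type*) [Field K] [CharP K 2] : AddMonoid.End K :=
  (frobenius K 2).toAddMonoidHom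

/-- Multiplication by a scalar as an additive endomorphism. -/
abbrev scalarEnd (K : Type*) [Field K] : K →+* AddMonoid.End K :=
  Module.toAddMonoidEnd K K

/-- The additive endomorphism `x ↦ ∑ i, aᵢ x ^ (2 ^ i)` attached to `∑ i, aᵢ X ^ i`. -/
noncomputable def twistedEval (P : K[X]) : AddMonoid.End K :=
  P.eval₂ (scalarEnd K) (frobEnd K)

theorem scalarEnd_apply {K : Type*} [Field K] (a x : K) : scalarEnd K a x = a * x := rfl

theorem frobEnd_apply (x : K) : frobEnd K x = x ^ 2 := rfl

theorem frobEnd_pow_apply (n : ℕ) (x : K) : (frobEnd K ^ n) x = x ^ 2 ^ n := by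
  rw [AddMonoid.End.coe_pow]
  exact iterate_frobenius 2 n x

theorem frobEnd_mul_scalarEnd (a : K) :
    frobEnd K * scalarEnd K a = scalarEnd K (a ^ 2) * frobEnd K := by
  ext x
  exact mul_pow a x 2

theorem frobEnd_pow_mul_scalarEnd (n : ℕ) (a : K) :
    frobEnd K ^ n * scalarEnd K a = scalarEnd K (a ^ 2 ^ n) * frobEnd K ^ n := by
  ext x
  change (frobEnd K ^ n) (a * x) = a ^ 2 ^ n * (frobEnd K ^ n) x
  rw [frobEnd_pow_apply, frobEnd_pow_apply, mul_pow]

theorem twistedEval_add (P Q : K[X]) : twistedEval (P + Q) = twistedEval P + twistedEval Q :=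
  eval₂_add _ _

theorem twistedEval_C (a : K) : twistedEval (C a) = scalarEnd K a :=
  eval₂_C _ _

theorem twistedEval_mul_X (P : K[X]) : twistedEval (P * X) = twistedEval P * frobEnd K :=
  eval₂_mul_X _ _

theorem twistedEval_C_mul_X_pow (a : K) (n : ℕ) :
    twistedEval (C a * X ^ n) = scalarEnd K a * frobEnd K ^ n := by
  rw [C_mul_X_pow_eq_monomial]
  exact eval₂_monomial _ _

theorem twistedEval_C_mul (a : K) (P : K[X]) :
    twistedEval (C a * P) = scalarEnd K a * twistedEval P := by
  induction P using Polynomial.induction_on with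
  | C b => rw [← C_mul, twistedEval_C, twistedEval_C, map_mul]
  | add P Q hP hQ => rw [mul_add, twistedEval_add, hP, hQ, twistedEval_add, mul_add]
  | monomial n b => rw [← mul_assoc, ← C_mul, twistedEval_C_mul_X_pow, twistedEval_C_mul_X_pow,
      map_mul, mul_assoc]

theorem twistedEval_apply (P : K[X]) (x : K) :
    twistedEval P x = ∑ i ∈ Finset.range (P.natDegree + 1), P.coeff i * x ^ 2 ^ i := by
  rw [twistedEval, eval₂_eq_sum_range]
  refine (AddMonoidHom.finsetSum_apply _ _ _).trans (Finset.sum_congr rfl fun i _ => ?_)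
  exact congrArg (P.coeff i * ·) (frobEnd_pow_apply i x)

theorem frobEnd_mul_twistedEval (P : K[X]) :
    frobEnd K * twistedEval P = twistedEval (P.map (frobenius K 2) * X) := by
  rw [twistedEval_mul_X]
  induction P using Polynomial.induction_on with
  | C b => rw [Polynomial.map_C, twistedEval_C, twistedEval_C, frobEnd_mul_scalarEnd]; rfl
  | add P Q hP hQ => rw [Polynomial.map_add, twistedEval_add, mul_add, hP, hQ, twistedEval_add,
      add_mul]
  | monomial n b =>
    rw [Polynomial.map_mul, Polynomial.map_pow, Polynomial.map_C, Polynomial.map_X,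
      twistedEval_C_mul_X_pow, twistedEval_C_mul_X_pow, ← mul_assoc, frobEnd_mul_scalarEnd,
      mul_assoc, mul_assoc, ← pow_succ, ← pow_succ']
    rfl

theorem exists_frobEnd_pow_mul_twistedEval (n : ℕ) (P : K[X]) :
    ∃ Q : K[X], frobEnd K ^ n * twistedEval P = twistedEval Q * frobEnd K ^ n := by
  induction n with
  | zero => exact ⟨P, by simp⟩
  | succ n ih =>
    obtain ⟨Q, hQ⟩ := ih
    refine ⟨Q.map (frobenius K 2), ?_⟩
    rw [pow_succ', mul_assoc, hQ, ← mul_assoc, frobEnd_mul_twistedEval, twistedEval_mul_X,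
      mul_assoc]

theorem exists_twistedEval_mul (P Q : K[X]) :
    ∃ S : K[X], twistedEval P * twistedEval Q = twistedEval S := by
  induction P using Polynomial.induction_on generalizing Q with
  | C a => exact ⟨C a * Q, by rw [twistedEval_C, twistedEval_C_mul]⟩
  | add P P' hP hP' =>
    obtain ⟨S, hS⟩ := hP Q
    obtain ⟨S', hS'⟩ := hP' Q
    exact ⟨S + S', by rw [twistedEval_add, twistedEval_add, add_mul, hS, hS']⟩
  | monomial n a ih =>
    -- The last Frobenius of the left factor is absorbed into `Q`, hence the induction over all `Q`.
    obtain ⟨S, hS⟩ := ih (Q.map (frobenius K 2) * X)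
    refine ⟨S, ?_⟩
    rw [pow_succ, ← mul_assoc, twistedEval_mul_X, mul_assoc, frobEnd_mul_twistedEval, hS]

/-- Right division with remainder by `F - v`. -/
theorem exists_twistedEval_eq_mul_sub_add (v : K) (N : ℕ) (P : K[X]) (hN : P.natDegree ≤ N) :
    ∃ (Q : K[X]) (k : K), Q.natDegree ≤ N - 1 ∧
      twistedEval P = twistedEval Q * (frobEnd K - scalarEnd K v) + scalarEnd K k := by
  refine Polynomial.induction_with_natDegree_le (fun P => ∃ (Q : K[X]) (k : K),
    Q.natDegree ≤ N - 1 ∧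
      twistedEval P = twistedEval Q * (frobEnd K - scalarEnd K v) + scalarEnd K k)
    N ?_ ?_ ?_ P hN
  · exact ⟨0, 0, by simp, by simp [twistedEval]⟩
  · rintro n r - hn
    clear hN
    induction n generalizing r with
    | zero => exact ⟨0, r, by simp, by simp [twistedEval]⟩
    | succ n ih =>
      -- `r F ^ (n + 1) = r F ^ n (F - v) + r v ^ (2 ^ n) F ^ n`.
      obtain ⟨Q, k, hQ, h⟩ := ih (r * v ^ 2 ^ n) (by omega)
      refine ⟨C r * X ^ n + Q, k, ?_, ?_⟩
      · exact (natDegree_add_le _ _).trans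
          (max_le ((natDegree_C_mul_X_pow_le _ _).trans (by omega)) hQ)
      · rw [twistedEval_add, add_mul, add_assoc, ← h, twistedEval_C_mul_X_pow,
          twistedEval_C_mul_X_pow, twistedEval_C_mul_X_pow, map_mul, mul_sub, mul_assoc,
          mul_assoc, mul_assoc, frobEnd_pow_mul_scalarEnd, pow_succ]
        abel
  · rintro P P' _ _ ⟨Q, k, hQ, h⟩ ⟨Q', k', hQ', h'⟩
    refine ⟨Q + Q', k + k', (natDegree_add_le _ _).trans (max_le hQ hQ'), ?_⟩
    rw [twistedEval_add, twistedEval_add, map_add, add_mul, h, h']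
    abel

/-- Divide the additive polynomial by `x`: the quotient `Q` is nonconstant, so it has a root, which
is nonzero because the constant term of `Q` is `P.coeff 0`. -/
theorem exists_twistedEval_apply_eq_zero [IsAlgClosed K] (P : K[X]) (h0 : P.coeff 0 ≠ 0)
    (hP : P.natDegree ≠ 0) : ∃ v : K, v ≠ 0 ∧ twistedEval P v = 0 := by
  obtain ⟨n, hn⟩ : ∃ n, n = P.natDegree := ⟨_, rfl⟩
  let Q : K[X] := ∑ i ∈ Finset.range (n + 1), C (P.coeff i) * X ^ (2 ^ i - 1)
  have hinj : ∀ i j : ℕ, 2 ^ i - 1 = 2 ^ j - 1 → i = j := fun i j h => by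
    have hi := Nat.one_le_two_pow (n := i)
    have hj := Nat.one_le_two_pow (n := j)
    exact Nat.pow_right_injective le_rfl (show 2 ^ i = 2 ^ j by omega)
  have hcoeff : ∀ j ≤ n, Q.coeff (2 ^ j - 1) = P.coeff j := by
    intro j hj
    simp only [Q, finsetSum_coeff, coeff_C_mul_X_pow]
    rw [Finset.sum_eq_single j]
    · simp
    · intro i _ hij
      exact if_neg fun h => hij (hinj _ _ h).symm
    · intro h
      exact absurd (Finset.mem_range.mpr (by omega)) h
  have hdeg : Q.degree ≠ 0 := by
    have h1 : Q.coeff (2 ^ n - 1) ≠ 0 := by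
      rw [hcoeff n le_rfl, hn, coeff_natDegree, leadingCoeff_ne_zero]
      rintro rfl
      simp at h0
    have h2 := le_natDegree_of_ne_zero h1
    have h3 : 1 < 2 ^ n := Nat.one_lt_two_pow (hn ▸ hP)
    intro h
    have h4 : Q.natDegree = 0 := natDegree_eq_of_degree_eq_some h
    omega
  obtain ⟨v, hv⟩ := IsAlgClosed.exists_root Q hdeg
  refine ⟨v, ?_, ?_⟩
  · rintro rfl
    rw [IsRoot.def, ← coeff_zero_eq_eval_zero] at hv
    exact h0 ((hcoeff 0 (Nat.zero_le _)).symm.trans hv)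
  · rw [twistedEval_apply]
    have : v * Q.eval v = ∑ i ∈ Finset.range (n + 1), P.coeff i * v ^ 2 ^ i := by
      simp only [Q, eval_finsetSum, eval_mul, eval_C, eval_pow, eval_X, Finset.mul_sum]
      refine Finset.sum_congr rfl fun i _ => ?_
      rw [mul_left_comm, ← pow_succ', Nat.sub_add_cancel Nat.one_le_two_pow]
    rw [← hn, ← this, hv.eq_zero, mul_zero]

theorem exists_mul_sq_sub_mul_eq {K : Type*} [Field K] [IsAlgClosed K] (a b k : K) (ha : a ≠ 0) :
    ∃ x : K, a * x ^ 2 - b * x = k := by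
  obtain ⟨x, hx⟩ := IsAlgClosed.exists_root (C a * X ^ 2 + C (-b) * X + C (-k))
    (by rw [degree_quadratic ha]; decide)
  refine ⟨x, ?_⟩
  simp only [IsRoot.def, eval_add, eval_mul, eval_C, eval_pow, eval_X] at hx
  linear_combination hx

/-! ### Twisted Laurent polynomials: factorization and the fadelian property. -/

/-- The ring of twisted Laurent polynomials over `K`, realized as the additive endomorphisms of `K`
that become additive polynomials after composition with a power of the Frobenius. -/
def twistedLaurent (K : Type*) [Field K] [CharP K 2] : Subring (AddMonoid.End K) where
  carrier := {f | ∃ (N : ℕ) (P : K[X]), frobEnd K ^ N * f = twistedEval P}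
  zero_mem' := ⟨0, 0, by simp [twistedEval]⟩
  one_mem' := ⟨0, 1, by simp [twistedEval]⟩
  add_mem' := by
    rintro f g ⟨M, P, hP⟩ ⟨N, Q, hQ⟩
    obtain ⟨P', hP'⟩ := exists_frobEnd_pow_mul_twistedEval N P
    obtain ⟨Q', hQ'⟩ := exists_frobEnd_pow_mul_twistedEval M Q
    refine ⟨M + N, P' * X ^ N + Q' * X ^ M, ?_⟩
    have hX : ∀ (S : K[X]) (n : ℕ), twistedEval (S * X ^ n) = twistedEval S * frobEnd K ^ n :=
      fun S n => by
        induction n with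
        | zero => simp
        | succ n ih => rw [pow_succ, ← mul_assoc, twistedEval_mul_X, ih, pow_succ, mul_assoc]
    rw [twistedEval_add, hX, hX, ← hP', ← hQ', ← hP, ← hQ, mul_add, ← mul_assoc, ← mul_assoc,
      ← pow_add, ← pow_add, add_comm N M]
  mul_mem' := by
    rintro f g ⟨M, P, hP⟩ ⟨N, Q, hQ⟩
    obtain ⟨P', hP'⟩ := exists_frobEnd_pow_mul_twistedEval N P
    obtain ⟨S, hS⟩ := exists_twistedEval_mul P' Q
    refine ⟨N + M, S, ?_⟩
    rw [← hS, ← hQ, ← mul_assoc (twistedEval P'), ← hP', ← hP, pow_add]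
    simp only [mul_assoc]
  neg_mem' := by
    rintro f ⟨N, P, hP⟩
    refine ⟨N, C (-1) * P, ?_⟩
    rw [twistedEval_C_mul, ← hP, map_neg, map_one]
    ext x
    exact map_neg (frobEnd K ^ N) (f x)

namespace twistedLaurent

theorem twistedEval_mem (P : K[X]) : twistedEval P ∈ twistedLaurent K :=
  ⟨0, P, by simp⟩

theorem scalarEnd_mem (a : K) : scalarEnd K a ∈ twistedLaurent K :=
  twistedEval_C a ▸ twistedEval_mem _

theorem frobEnd_mem : frobEnd K ∈ twistedLaurent K :=
  ⟨0, X, by simp [twistedEval]⟩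

/-- The element `F - v`. -/
def linear (v : K) : twistedLaurent K :=
  ⟨frobEnd K - scalarEnd K v, sub_mem frobEnd_mem (scalarEnd_mem v)⟩

variable (K) in
/-- The Frobenius as a twisted Laurent polynomial. -/
def frob : twistedLaurent K := ⟨frobEnd K, frobEnd_mem⟩

theorem isUnit_frob [PerfectRing K 2] : IsUnit (frob K) := by
  let g : AddMonoid.End K := (frobeniusEquiv K 2).symm.toAddEquiv.toAddMonoidHom
  have h1 : frobEnd K * g = 1 := by
    ext x
    exact frobenius_apply_frobeniusEquiv_symm K 2 x
  have h2 : g * frobEnd K = 1 := by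
    ext x
    exact frobeniusEquiv_symm_apply_frobenius K 2 x
  exact ⟨⟨frob K, ⟨g, 1, 1, by rw [pow_one, h1]; simp [twistedEval]⟩, Subtype.ext h1,
    Subtype.ext h2⟩, rfl⟩

theorem isUnit_scalarEnd (a : K) (ha : a ≠ 0) :
    IsUnit (⟨scalarEnd K a, scalarEnd_mem a⟩ : twistedLaurent K) :=
  ⟨⟨_, ⟨scalarEnd K a⁻¹, scalarEnd_mem _⟩,
    Subtype.ext (by simp [MulMemClass.mk_mul_mk, ← map_mul, ha]),
    Subtype.ext (by simp [MulMemClass.mk_mul_mk, ← map_mul, ha])⟩, rfl⟩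

variable (K) in
/-- Units together with the `F - v` for `v ≠ 0`. -/
def factors : Set (twistedLaurent K) :=
  {f | IsUnit f ∨ ∃ v : K, v ≠ 0 ∧ f = linear v}

theorem linear_one_apply_one : (linear (1 : K) : AddMonoid.End K) 1 = 0 := by
  change frobEnd K 1 - scalarEnd K 1 1 = 0
  simp [frobEnd_apply]

/-- `F - 1` kills `1`, so it is not injective. -/
theorem mul_linear_one_ne_one (c : twistedLaurent K) : c * linear 1 ≠ 1 := by
  intro h
  have h1 := DFunLike.congr_fun (congrArg Subtype.val h : _ = (1 : AddMonoid.End K)) 1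
  change (c : AddMonoid.End K) ((linear (1 : K) : AddMonoid.End K) 1) = 1 at h1
  rw [linear_one_apply_one, map_zero] at h1
  exact zero_ne_one h1

variable [IsAlgClosed K]

theorem twistedEval_mem_closure_factors (n : ℕ) (P : K[X]) (hn : P.natDegree ≤ n)
    (hP : twistedEval P ≠ 0) :
    (⟨twistedEval P, twistedEval_mem P⟩ : twistedLaurent K) ∈ Submonoid.closure (factors K) := by
  induction n generalizing P with
  | zero =>
    obtain ⟨a, rfl⟩ := natDegree_eq_zero.mp (Nat.le_zero.mp hn)
    have ha : a ≠ 0 := by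
      rintro rfl
      exact hP (by rw [twistedEval_C, map_zero])
    have := isUnit_scalarEnd a ha
    simp only [← twistedEval_C] at this
    exact Submonoid.subset_closure (Or.inl this)
  | succ n ih =>
    by_cases h0 : P.coeff 0 = 0
    · have hdiv : P.divX * X = P := by
        have := divX_mul_X_add P
        rwa [h0, C_0, add_zero] at this
      have hfac : twistedEval P = twistedEval P.divX * frobEnd K := by
        rw [← twistedEval_mul_X, hdiv]
      have hne : twistedEval P.divX ≠ 0 := fun h => hP (by rw [hfac, h, zero_mul])
      have hmem := mul_mem (ih P.divX (by rw [natDegree_divX_eq_natDegree_tsub_one]; omega) hne)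
        (Submonoid.subset_closure (Or.inl isUnit_frob))
      convert hmem using 1
      exact Subtype.ext hfac
    · by_cases hd : P.natDegree = 0
      · exact ih P (by omega) hP
      · obtain ⟨v, hv, hv0⟩ := exists_twistedEval_apply_eq_zero P h0 hd
        obtain ⟨Q, k, hQ, hdiv⟩ := exists_twistedEval_eq_mul_sub_add v (n + 1) P hn
        -- Evaluate the division at `v`, which both `P` and `F - v` annihilate: `k * v = 0`.
        have hk : k = 0 := by
          have h := DFunLike.congr_fun hdiv v
          have hzero : (frobEnd K - scalarEnd K v) v = 0 := by
            change frobEnd K v - scalarEnd K v v = 0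
            rw [frobEnd_apply, scalarEnd_apply, sq, sub_self]
          change _ = twistedEval Q ((frobEnd K - scalarEnd K v) v) + k * v at h
          rw [hv0, hzero, map_zero, zero_add] at h
          exact (mul_eq_zero.mp h.symm).resolve_right hv
        rw [hk, map_zero, add_zero] at hdiv
        have hne : twistedEval Q ≠ 0 := fun h => hP (by rw [hdiv, h, zero_mul])
        have hmem := mul_mem (ih Q hQ hne) (Submonoid.subset_closure (s := factors K)
          (Or.inr ⟨v, hv, rfl⟩))
        convert hmem using 1
        exact Subtype.ext hdiv

theorem mem_closure_factors (f : twistedLaurent K) (hf : f ≠ 0) :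
    f ∈ Submonoid.closure (factors K) := by
  obtain ⟨N, P, hP⟩ := f.2
  obtain ⟨u, hu⟩ := (isUnit_frob (K := K)).pow N
  have hfac : frob K ^ N * f = ⟨twistedEval P, twistedEval_mem P⟩ := Subtype.ext hP
  have hne : twistedEval P ≠ 0 := by
    intro h
    apply hf
    rw [← hu] at hfac
    rw [← Units.mul_right_eq_zero u, hfac]
    exact Subtype.ext h
  have hmem := twistedEval_mem_closure_factors _ P le_rfl hne
  rw [← hfac, ← hu] at hmem
  have := mul_mem (Submonoid.subset_closure (s := factors K) (Or.inl u⁻¹.isUnit)) hmem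
  rwa [Units.inv_mul_cancel_left] at this

/-- Each factor is onto: a unit is bijective, and `x ^ 2 - v x = y` is solvable. Composites of
surjections are nonzero, so the ring is a domain. -/
theorem surjective_of_ne_zero (f : twistedLaurent K) (hf : f ≠ 0) :
    Function.Surjective (f : AddMonoid.End K) := by
  have hmem := mem_closure_factors f hf
  clear hf
  induction hmem using Submonoid.closure_induction with
  | mem f hf =>
    rcases hf with hf | ⟨v, -, rfl⟩
    · obtain ⟨g, hg⟩ := hf.exists_right_inv
      exact fun y => ⟨(g : AddMonoid.End K) y,
        DFunLike.congr_fun (congrArg Subtype.val hg : _ = (1 : AddMonoid.End K)) y⟩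
    · intro y
      obtain ⟨x, hx⟩ := exists_mul_sq_sub_mul_eq 1 v y one_ne_zero
      exact ⟨x, by rw [one_mul] at hx; exact hx⟩
  | one => exact fun y => ⟨y, rfl⟩
  | mul f g _ _ hf hg => exact hf.comp hg

instance : NoZeroDivisors (twistedLaurent K) where
  eq_zero_or_eq_zero_of_mul_eq_zero {f g} h := by
    by_contra! hne
    have hs := (surjective_of_ne_zero f hne.1).comp (surjective_of_ne_zero g hne.2)
    obtain ⟨x, hx⟩ := hs 1
    exact one_ne_zero (hx.symm.trans
      (DFunLike.congr_fun (congrArg Subtype.val h : _ = (0 : AddMonoid.End K)) x))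

theorem exists_eq_linear_mul_add_mul_linear (v w : K) (hw : w ≠ 0) (f : twistedLaurent K) :
    ∃ b c : twistedLaurent K, f = linear v * b + c * linear w := by
  obtain ⟨N, P, hP⟩ := f.2
  obtain ⟨u, hu⟩ := (isUnit_frob (K := K)).pow N
  obtain ⟨Q, k, -, hdiv⟩ := exists_twistedEval_eq_mul_sub_add w _ P le_rfl
  -- With `v' = v ^ 2 ^ N`, the terms in `F` cancel in `(F - v') b - b ^ 2 (F - w) = w b ^ 2 - v'
  -- b`; choose `b` to make this the remainder `k`.
  obtain ⟨b, hb⟩ := exists_mul_sq_sub_mul_eq w (v ^ 2 ^ N) k hw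
  have hcomm : frob K ^ N * linear v = linear (v ^ 2 ^ N) * frob K ^ N := by
    refine Subtype.ext ?_
    change frobEnd K ^ N * (frobEnd K - scalarEnd K v) =
      (frobEnd K - scalarEnd K (v ^ 2 ^ N)) * frobEnd K ^ N
    rw [mul_sub, sub_mul, frobEnd_pow_mul_scalarEnd, ← pow_succ, ← pow_succ']
  let β : twistedLaurent K := ⟨scalarEnd K b, scalarEnd_mem b⟩
  let γ : twistedLaurent K :=
    ⟨twistedEval Q, twistedEval_mem Q⟩ - ⟨scalarEnd K (b ^ 2), scalarEnd_mem _⟩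
  have hmain : frob K ^ N * f = linear (v ^ 2 ^ N) * β + γ * linear w := by
    refine Subtype.ext ?_
    change frobEnd K ^ N * (f : AddMonoid.End K) =
      (frobEnd K - scalarEnd K (v ^ 2 ^ N)) * scalarEnd K b +
        (twistedEval Q - scalarEnd K (b ^ 2)) * (frobEnd K - scalarEnd K w)
    rw [hP, hdiv, ← hb, sub_mul, sub_mul, mul_sub (scalarEnd K (b ^ 2)), frobEnd_mul_scalarEnd,
      ← map_mul, ← map_mul, map_sub, mul_comm w]
    abel
  refine ⟨(u⁻¹ : (twistedLaurent K)ˣ) * β, (u⁻¹ : (twistedLaurent K)ˣ) * γ, ?_⟩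
  rw [← hu] at hmain hcomm
  have hcomm' : linear v * ((u⁻¹ : (twistedLaurent K)ˣ) : twistedLaurent K) =
      ((u⁻¹ : (twistedLaurent K)ˣ) : twistedLaurent K) * linear (v ^ 2 ^ N) := by
    rw [Units.mul_inv_eq_iff_eq_mul, mul_assoc, ← hcomm, Units.inv_mul_cancel_left]
  rw [← mul_assoc, hcomm', mul_assoc, mul_assoc, ← mul_add, ← hmain, Units.inv_mul_cancel_left]

instance : Nontrivial (twistedLaurent K) :=
  ⟨0, 1, fun h => zero_ne_one (α := K)
    (DFunLike.congr_fun (congrArg Subtype.val h : (0 : AddMonoid.End K) = 1) 1)⟩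

theorem isFadelian : IsFadelian (twistedLaurent K) := by
  refine IsFadelian.of_closure (factors K) mem_closure_factors ?_
  rintro g (hg | ⟨v, -, rfl⟩) h hh x
  · obtain ⟨u, rfl⟩ := hg
    exact ⟨(u⁻¹ : (twistedLaurent K)ˣ) * x, 0, by simp⟩
  · rcases hh with hh | ⟨w, hw, rfl⟩
    · obtain ⟨u, rfl⟩ := hh
      exact ⟨0, x * (u⁻¹ : (twistedLaurent K)ˣ), by simp⟩
    · exact exists_eq_linear_mul_add_mul_linear v w hw x

theorem linear_one_ne_zero : linear (1 : K) ≠ 0 := by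
  intro h
  obtain ⟨x, hx⟩ := exists_mul_sq_sub_mul_eq (1 : K) 1 1 one_ne_zero
  rw [one_mul] at hx
  exact one_ne_zero (hx.symm.trans
    (DFunLike.congr_fun (congrArg Subtype.val h : _ = (0 : AddMonoid.End K)) x))

theorem linear_one_mul_ne_one (c : twistedLaurent K) : linear 1 * c ≠ 1 := by
  intro h
  refine mul_linear_one_ne_one c (mul_left_cancel₀ linear_one_ne_zero ?_)
  rw [← mul_assoc, h, one_mul, mul_one]

end twistedLaurent

end TwistedPolynomials

theorem mainTheorem7 :
    ∃ (R : Type) (_ : Ring R),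
      Countable R ∧ IsFadelian R ∧ ¬ IsLeftNoetherian R ∧ ¬ IsRightNoetherian R := by
  have : CharP (AlgebraicClosure (ZMod 2)) 2 :=
    charP_of_injective_algebraMap (algebraMap (ZMod 2) _).injective 2
  exact (twistedLaurent.isFadelian (K := AlgebraicClosure (ZMod 2))).exists_countable_not_noetherian
    _ twistedLaurent.linear_one_ne_zero twistedLaurent.mul_linear_one_ne_one
    twistedLaurent.linear_one_mul_ne_one
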